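/- **Model.** Time is divided into slots $0,1,2,\dots$; there are a data channel and a control channel. An adversary injects exactly $n\ge 1$ packets into the system, where $n$ is fixed in advance and unknown to the packets. At the start of every slot the adversary, knowing everything that happened in the earlier slots and the current state of all packets but not the random choices of the current slot, decides which packets arrive in this slot and whether each of the two channels is disrupted in it. A channel is heard as *empty* in a slot if nobody broadcasts on it and it is not disrupted; otherwise it is heard as *full*. A slot is *successful* if the data channel is not disrupted and exactly one packet is broadcast on it; this packet then has been transmitted and leaves the system. A packet is *live* from its arrival until its successful transmission. Slots without a live packet are ignored everywhere. Let $D$ be the number of slots in which at least one channel is disrupted; let the *makespan* $T$ be the number of slots until the last packet completes ($T=\infty$ if some packet never does); and let the *throughput* be the fraction of the slots of the execution that are successful, i.e. $n/T$ if all $n$ packets complete, and $0$ if $T=\infty$. **Protocol Re-Backoff** (with parameter $\kappa>0$, $d=1/2$, $\gamma=15/16$). A packet is inactive when it arrives. If an inactive packet hears an empty control slot, it becomes active in the next slot. A packet in its $s$-th slot since it became active independently broadcasts its message on the data channel with probability $d/s$, and a busy tone on the control channel with probability $\min\{1,\kappa\max\{\ln s,1\}/s\}$. If it does not succeed in this slot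 and at least $\gamma s$ of the $s$ data slots since it became active (including this one) were empty, it becomes inactive again, and the process repeats; otherwise it stays active. All random choices are independent. **Statement.** For every $\kappa>0$ there are constants $c>0$, $\lambda>0$ and $C$, depending on $\kappa$ only, such that for every $n\ge 1$ and every adversary that almost surely injects all $n$ packets and for which $D\le cn$ almost surely, Re-Backoff achieves expected constant throughput: the expected throughput is at least $\lambda$. More strongly, the expected makespan satisfies $\mathbb{E}[T]\le Cn$. -/

import Mathlib

open MeasureTheory
open scoped ENNReal NNReal

noncomputable section

namespace ReBackoff

/-- The status of a packet at the start of a slot. An active packet in state `active s e` is in the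
`s`-th slot of its current activation (so `1 ≤ s`), and has observed `e` empty data slots earlier in
this activation. -/
inductive PacketState where
  | notArrived : PacketState
  | inactive : PacketState
  | active (age empties : ℕ) : PacketState
  | finished : PacketState
  deriving DecidableEq

/-- A packet is live from its arrival until its successful transmission. -/
def PacketState.Live : PacketState → Prop
  | .notArrived => False
  | .inactive => True
  | .active _ _ => True
  | .finished => False

/-- The constant `d` of the protocol. -/
def dConst : ℝ := 1 / 2

/-- The constant `γ` of the protocol. -/
def gammaConst : ℝ := 15 / 16

/-- The probability with which a packet sends its message on the data channel: `d / s` for an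
active packet of age `s`. -/
def dataProb : PacketState → ℝ
  | .active s _ => dConst / s
  | _ => 0

/-- The probability with which a packet sends the busy tone on the control channel:
`κ * max (ln s) 1 / s` for an active packet of age `s`. A value above `1` means that the busy tone
is sent for certain. -/
def controlProb (κ : ℝ) : PacketState → ℝ
  | .active s _ => κ * max (Real.log s) 1 / s
  | _ => 0

/-- The states of all `n` packets. -/
abbrev Config (n : ℕ) := Fin n → PacketState

/-- The decisions of the adversary for one slot: which of the packets that have not arrived yet
arrive now, and which of the two channels are disrupted. -/
structure Action (n : ℕ) where
  arrivals : Finset (Fin n)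
  jamData : Bool
  jamControl : Bool

/-- Everything that happens in one slot: the configuration at its start, the decisions of the
adversary, and the sets of packets that broadcast on the data and on the control channel. -/
structure Slot (n : ℕ) where
  start : Config n
  action : Action n
  dataSenders : Finset (Fin n)
  controlSenders : Finset (Fin n)

namespace Slot

variable {n : ℕ} (x : Slot n)

/-- The configuration during the slot, after the arrivals. New packets are inactive. -/
def config : Config n := fun i =>
  if x.start i = .notArrived ∧ i ∈ x.action.arrivals then .inactive else x.start i

/-- Some packet is live during the slot. -/
def IsLive : Prop := ∃ i, (x.config i).Live

/-- The slot is disrupted (on at least one of the channels). -/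
def IsDisrupted : Prop := x.action.jamData = true ∨ x.action.jamControl = true

/-- The data channel is heard as empty: no broadcast and no disruption. -/
def DataEmpty : Prop := x.action.jamData = false ∧ x.dataSenders = ∅

/-- The control channel is heard as empty: no busy tone and no disruption. -/
def ControlEmpty : Prop := x.action.jamControl = false ∧ x.controlSenders = ∅

/-- Packet `i` is the only one to broadcast on the data channel, which is not disrupted. -/
def SucceedsFor (i : Fin n) : Prop := x.action.jamData = false ∧ x.dataSenders = {i}

/-- The slot is successful. -/
def IsSuccessful : Prop := ∃ i, x.SucceedsFor i

open Classical in
/-- The configuration at the start of the next slot.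
* An inactive packet becomes active (with age `1`) in the next slot if the control slot was empty.
* An active packet that transmitted successfully is finished. Otherwise it becomes inactive if at
  least a `γ`-fraction of the data slots since its activation (including this one) were empty,
  and else stays active. -/
def next : Config n := fun i =>
  match x.config i with
  | .notArrived => .notArrived
  | .finished => .finished
  | .inactive => if x.ControlEmpty then .active 1 0 else .inactive
  | .active s e =>
      if x.SucceedsFor i then .finished
      else
        let e' : ℕ := if x.DataEmpty then e + 1 else e
        if gammaConst * (s : ℝ) ≤ (e' : ℝ) then .inactive else .active (s + 1) e'

end Slot

/-- An adaptive adversary for an instance with `n` packets. It decides on the arrivals and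
disruptions of a slot knowing all that happened in the earlier slots (most recent slot first) and
the current configuration, but not the random choices of the packets in the current slot. -/
abbrev Adversary (n : ℕ) := List (Slot n) → Config n → Action n

/-- The random numbers behind the choices of the packets: `(ω t i).1` and `(ω t i).2` are used by
packet `i` in slot `t`, on the data channel and on the control channel respectively. -/
abbrev Coins (n : ℕ) := ℕ → Fin n → unitInterval × unitInterval

/-- All random numbers are independent and uniform on `[0, 1]`. -/
def coinMeasure (n : ℕ) : Measure (Coins n) :=
  Measure.infinitePi fun _ : ℕ =>
    Measure.pi fun _ : Fin n =>
      (volume : Measure unitInterval).prod (volume : Measure unitInterval)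

/-- One slot of the protocol: a packet broadcasts with the probability that its state prescribes. -/
def playSlot (κ : ℝ) {n : ℕ} (σ : Config n) (a : Action n)
    (u : Fin n → unitInterval × unitInterval) : Slot n where
  start := σ
  action := a
  dataSenders := Finset.univ.filter fun i => ((u i).1 : ℝ) < dataProb (σ i)
  controlSenders := Finset.univ.filter fun i => ((u i).2 : ℝ) < controlProb κ (σ i)

/-- The past slots (most recent first) and the configuration at the start of slot `t`. -/
def run (κ : ℝ) {n : ℕ} (A : Adversary n) (ω : Coins n) : ℕ → List (Slot n) × Config n
  | 0 => ([], fun _ => .notArrived)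
  | t + 1 =>
      let past := (run κ A ω t).1
      let σ := (run κ A ω t).2
      let x := playSlot κ σ (A past σ) (ω t)
      (x :: past, x.next)

/-- Slot `t` of the execution. -/
def slotAt (κ : ℝ) {n : ℕ} (A : Adversary n) (ω : Coins n) (t : ℕ) : Slot n :=
  playSlot κ (run κ A ω t).2 (A (run κ A ω t).1 (run κ A ω t).2) (ω t)

/-- All `n` packets are injected eventually. -/
def InjectsAll (κ : ℝ) {n : ℕ} (A : Adversary n) (ω : Coins n) : Prop :=
  ∀ i, ∃ t, (slotAt κ A ω t).config i ≠ .notArrived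

open Classical in
/-- The makespan `T`: the number of slots until the last packet completes, where slots without a
live packet are ignored. It is infinite if some packet that arrives never completes. -/
def makespan (κ : ℝ) {n : ℕ} (A : Adversary n) (ω : Coins n) : ℝ≥0∞ :=
  ∑' t : ℕ, if (slotAt κ A ω t).IsLive then 1 else 0

open Classical in
/-- The number `D` of disrupted slots (slots without a live packet are ignored). -/
def disruptedSlots (κ : ℝ) {n : ℕ} (A : Adversary n) (ω : Coins n) : ℝ≥0∞ :=
  ∑' t : ℕ, if (slotAt κ A ω t).IsLive ∧ (slotAt κ A ω t).IsDisrupted then 1 else 0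

open Classical in
/-- The number of successful slots. -/
def successfulSlots (κ : ℝ) {n : ℕ} (A : Adversary n) (ω : Coins n) : ℝ≥0∞ :=
  ∑' t : ℕ, if (slotAt κ A ω t).IsSuccessful then 1 else 0

/-- The throughput of the execution: the fraction of its slots that are successful. -/
def throughput (κ : ℝ) {n : ℕ} (A : Adversary n) (ω : Coins n) : ℝ≥0∞ :=
  successfulSlots κ A ω / makespan κ A ω

end ReBackoff

end

/-!
The proof is a potential argument. A function `potential` of the configuration is exhibited whose
expected change in a slot with a live packet is at most `-1 / 4`, or at most a constant if the slot
is disrupted. It does not change at arrivals and starts at `O(n)`, so summation over all slots gives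
`E[T] = O(n + D) = O(n)`. The adversary is adaptive, but the randomness of a slot is independent of
the history (`indepFun_run`), so it suffices to bound the change for every fixed configuration and
action (`integral_potential_next_le_sub`). By Markov's inequality the makespan is `O(n)` with
probability at least `1 / 2`, which yields the throughput.

The potential is a weighted sum of three parts. Let `X = ∑ 1 / s` denote the contention, the sum
being over the ages `s` of the active packets.

* The `credit` bounds the number of activations. A packet of age `s` succeeds with probability at
  least `1 / (2 s)` times the probability that the data channel is empty
  (`mul_slotProb_dataEmpty_le`).
  An active packet may therefore gain credit `1 / s` for every empty slot, at the expense of the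
  credit that it loses by a success. A packet that becomes inactive has gained at least `15 / 16` in
  this way, of which it gives back `1 / 2` at its next activation (`Slot.credit_next_le`).
* The `relaxTime` is the time until the contention has fallen to a constant `b` if there are no
  activations. It falls by one in every slot with `X > b`. An activation of `A` packets raises it by
  `O(A)`, which their credit pays for, unless the packets that are already active will still cause
  contention of order `b` a long time `h` later. Owing to the logarithm in the probabilities of the
  control channel, an empty control slot then has probability at most `1 / h ^ 2`, provided that
  `b ≥ 8 / κ` (`mul_relapseTime_le`).
* The `maxDebt` is the time until all active packets become inactive if the data channel stays
  empty. It falls in expectation in every slot in which `X` is below a small constant. If it is zero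
  there, then nobody is active, so that the control channel is empty and all inactive packets are
  activated, which releases credit.

If `X` lies between the small constant and `b`, then some packet succeeds with constant probability,
and the credit it loses outweighs everything else.
-/

noncomputable section

namespace ReBackoff

variable {n : ℕ}

/-! ### The three components of the potential -/

/-- The contention `1 / s` that a packet of age `s` causes, after ageing by `τ` further slots. -/
def contribution (τ : ℕ) : PacketState → ℝ
  | .active s _ => 1 / ((s : ℝ) + τ)
  | _ => 0

/-- The total contention `∑ 1 / (s + τ)` of the active packets, after ageing by `τ` further
slots. -/
def contention (σ : Config n) (τ : ℕ) : ℝ := ∑ i, contribution τ (σ i)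

/-- The number of slots until the contention has fallen to `b`, if no packet is activated. -/
def relaxTime (b : ℝ) (σ : Config n) : ℕ := sInf {τ | contention σ τ ≤ b}

/-- The number of inactive packets. -/
def inactiveCount (σ : Config n) : ℕ := (Finset.univ.filter fun i => σ i = .inactive).card

/-- An upper bound on the `relaxTime` of the next configuration if all inactive packets are
activated now. If there are none, activation has no effect, which is encoded by `0`. -/
def relapseTime (b : ℝ) (σ : Config n) : ℕ :=
  if inactiveCount σ = 0 then 0
  else sInf {τ : ℕ | contention σ (τ + 1) + (inactiveCount σ : ℝ) / (τ + 1) ≤ b}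

/-- The number of empty data slots in a row after which an active packet becomes inactive: the least
`r` with `e + r ≥ 15 / 16 * (s - 1 + r)`. It is `0` for a packet in its first slot. -/
def debt : PacketState → ℕ
  | .active s e => 15 * (s - 1) - 16 * e
  | _ => 0

/-- The largest debt of a packet. -/
def maxDebt (σ : Config n) : ℕ := Finset.univ.sup fun i => debt (σ i)

/-- The credit of a packet. An active packet owns, besides a basic credit of `4`, the sum of `1 / k`
over the ages `k` at which it observed an empty data slot. As the state records only the number `e`
of these slots, the sum is given its least possible value, that for the `e` most recent slots. -/
def credit : PacketState → ℝ
  | .notArrived => 9 / 2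
  | .inactive => 9 / 2
  | .active s e => 4 + ∑ k ∈ Finset.Ico (s - e) s, (1 : ℝ) / k
  | .finished => 0

/-- The states of a packet that can occur in an execution: an active packet is in its first slot,
or the empty slots have not yet sufficed to make it inactive. -/
def WellFormed : PacketState → Prop
  | .active s e => 1 ≤ s ∧ (s = 1 ∧ e = 0 ∨ 16 * e < 15 * (s - 1))
  | _ => True

open Classical in
/-- The indicator of a proposition, as a real number. -/
def ind (p : Prop) : ℝ := if p then 1 else 0

/-- The indicator of the active states. -/
def activeInd : PacketState → ℝ
  | .active _ _ => 1
  | _ => 0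

/-- The indicator of the inactive state. -/
def inactiveInd : PacketState → ℝ
  | .inactive => 1
  | _ => 0

/-! ### One slot, seen from one packet -/

lemma ind_true {p : Prop} (h : p) : ind p = 1 := by simp [ind, h]
lemma ind_false {p : Prop} (h : ¬ p) : ind p = 0 := by simp [ind, h]
lemma ind_nonneg (p : Prop) : 0 ≤ ind p := by unfold ind; split_ifs <;> norm_num

lemma contribution_nonneg (τ : ℕ) (p : PacketState) : 0 ≤ contribution τ p := by
  cases p <;> simp [contribution]; positivity

lemma contribution_anti {τ τ' : ℕ} (h : τ ≤ τ') {p : PacketState} (hp : WellFormed p) :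
    contribution τ' p ≤ contribution τ p := by
  cases p with
  | active s e =>
    have h1 : (1 : ℝ) ≤ s := by exact_mod_cast hp.1
    have h2 : (τ : ℝ) ≤ τ' := by exact_mod_cast h
    simp only [contribution]
    gcongr
  | _ => simp [contribution]

lemma credit_nonneg (p : PacketState) : 0 ≤ credit p := by
  cases p <;> simp only [credit] <;> positivity

lemma dataProb_eq (p : PacketState) : dataProb p = contribution 0 p / 2 := by
  cases p <;> simp [dataProb, contribution, dConst]; ring

lemma reset_iff (s e : ℕ) : gammaConst * (s : ℝ) ≤ (e : ℝ) ↔ 15 * s ≤ 16 * e := by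
  rw [← Nat.cast_le (α := ℝ)]
  push_cast
  unfold gammaConst
  constructor <;> intro h <;> linarith

namespace Slot

variable (x : Slot n) (i : Fin n)

lemma next_active {s e : ℕ} (h : x.config i = .active s e) :
    (x.SucceedsFor i ∧ x.next i = .finished) ∨
    (¬ x.SucceedsFor i ∧ x.DataEmpty ∧
      ((15 * s ≤ 16 * (e + 1) ∧ x.next i = .inactive) ∨
        (16 * (e + 1) < 15 * s ∧ x.next i = .active (s + 1) (e + 1)))) ∨
    (¬ x.SucceedsFor i ∧ ¬ x.DataEmpty ∧
      ((15 * s ≤ 16 * e ∧ x.next i = .inactive) ∨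
        (16 * e < 15 * s ∧ x.next i = .active (s + 1) e))) := by
  unfold Slot.next
  rw [h]
  simp only [reset_iff]
  by_cases h1 : x.SucceedsFor i
  · simp [h1]
  · by_cases h2 : x.DataEmpty
    · by_cases h3 : 15 * s ≤ 16 * (e + 1) <;> simp [h1, h2, h3]; omega
    · by_cases h3 : 15 * s ≤ 16 * e <;> simp [h1, h2, h3]; omega

lemma next_inactive (h : x.config i = .inactive) :
    (x.ControlEmpty ∧ x.next i = .active 1 0) ∨ (¬ x.ControlEmpty ∧ x.next i = .inactive) := by
  unfold Slot.next
  rw [h]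
  by_cases h1 : x.ControlEmpty <;> simp [h1]

lemma next_notArrived (h : x.config i = .notArrived) : x.next i = .notArrived := by
  simp [Slot.next, h]

lemma next_finished (h : x.config i = .finished) : x.next i = .finished := by
  simp [Slot.next, h]

lemma not_dataEmpty_of_succeedsFor (h : x.SucceedsFor i) : ¬ x.DataEmpty := by
  intro h2
  simpa [h.2] using h2.2

lemma wellFormed_next : WellFormed (x.next i) := by
  cases hc : x.config i with
  | notArrived => simp [x.next_notArrived i hc, WellFormed]
  | finished => simp [x.next_finished i hc, WellFormed]
  | inactive => rcases x.next_inactive i hc with ⟨-, h⟩ | ⟨-, h⟩ <;> simp [h, WellFormed]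
  | active s e =>
    rcases x.next_active i hc with ⟨-, h⟩ | ⟨-, -, ⟨-, h⟩ | ⟨h1, h⟩⟩ | ⟨-, -, ⟨-, h⟩ | ⟨h1, h⟩⟩ <;>
      rw [h] <;> simp only [WellFormed] <;> omega

/-- A packet is activated with contention `1` and ages by one slot otherwise. -/
lemma contribution_next_le (τ : ℕ) :
    contribution τ (x.next i) ≤ contribution (τ + 1) (x.config i) +
      inactiveInd (x.config i) * ind x.ControlEmpty / (τ + 1) := by
  have h0 : (0 : ℝ) ≤ 1 / (τ + 1) := by positivity
  cases hc : x.config i with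
  | notArrived => simp [x.next_notArrived i hc, contribution, inactiveInd]
  | finished => simp [x.next_finished i hc, contribution, inactiveInd]
  | inactive =>
    rcases x.next_inactive i hc with ⟨h1, h⟩ | ⟨h1, h⟩
    · simp [h, contribution, inactiveInd, ind_true h1, add_comm]
    · simp [h, contribution, inactiveInd, ind_false h1]
  | active s e =>
    have h2 : (0 : ℝ) ≤ 1 / ((s : ℝ) + (τ + 1)) := by positivity
    rcases x.next_active i hc with ⟨-, h⟩ | ⟨-, -, ⟨-, h⟩ | ⟨h1, h⟩⟩ | ⟨-, -, ⟨-, h⟩ | ⟨h1, h⟩⟩ <;>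
      rw [h] <;> simp [contribution, inactiveInd] <;> first | positivity | (ring_nf; rfl)

lemma debt_next_le_of_dataEmpty (hw : WellFormed (x.config i)) (hE : x.DataEmpty) :
    debt (x.next i) ≤ debt (x.config i) - 1 := by
  cases hc : x.config i with
  | notArrived => simp [x.next_notArrived i hc, debt]
  | finished => simp [x.next_finished i hc, debt]
  | inactive => rcases x.next_inactive i hc with ⟨-, h⟩ | ⟨-, h⟩ <;> simp [h, debt]
  | active s e =>
    rw [hc] at hw
    have := hw.1
    rcases x.next_active i hc with ⟨-, h⟩ | ⟨-, -, ⟨-, h⟩ | ⟨_, h⟩⟩ | ⟨-, h, -⟩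
    · simp [h, debt]
    · simp [h, debt]
    · rw [h]; simp only [debt]; omega
    · exact absurd hE h

lemma debt_next_le (hw : WellFormed (x.config i)) :
    debt (x.next i) ≤ debt (x.config i) + 15 := by
  cases hc : x.config i with
  | notArrived => simp [x.next_notArrived i hc, debt]
  | finished => simp [x.next_finished i hc, debt]
  | inactive => rcases x.next_inactive i hc with ⟨-, h⟩ | ⟨-, h⟩ <;> simp [h, debt]
  | active s e =>
    rw [hc] at hw
    have := hw.1
    rcases x.next_active i hc with ⟨-, h⟩ | ⟨-, -, ⟨-, h⟩ | ⟨h1, h⟩⟩ | ⟨-, -, ⟨-, h⟩ | ⟨h1, h⟩⟩ <;>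
      rw [h] <;> simp only [debt] <;> omega

/-- The change of the credit of a packet. An empty slot raises the credit of an active packet of
age `s` by `1 / s`, a success costs `4`, and an activation costs `1 / 2`. A packet that becomes
inactive has observed `15 / 16 * s` empty slots at ages up to `s`, so that its credit is large
enough for the inactive state. -/
lemma credit_next_le (hw : WellFormed (x.config i)) :
    credit (x.next i) ≤ credit (x.config i) + contribution 0 (x.config i) * ind x.DataEmpty
      - 4 * (activeInd (x.config i) * ind (x.SucceedsFor i))
      - 1 / 2 * (inactiveInd (x.config i) * ind x.ControlEmpty) := by
  cases hc : x.config i with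
  | notArrived => simp [x.next_notArrived i hc, credit, contribution, activeInd, inactiveInd]
  | finished => simp [x.next_finished i hc, credit, contribution, activeInd, inactiveInd]
  | inactive =>
    rcases x.next_inactive i hc with ⟨h1, h⟩ | ⟨h1, h⟩
    · simp [h, credit, contribution, activeInd, inactiveInd, ind_true h1]; norm_num
    · simp [h, credit, contribution, activeInd, inactiveInd, ind_false h1]
  | active s e =>
    rw [hc] at hw
    obtain ⟨hs, hw⟩ := hw
    have hes : e < s := by omega
    have hs0 : (0 : ℝ) < s := by exact_mod_cast hs
    have hsum : 0 ≤ ∑ k ∈ Finset.Ico (s - e) s, (1 : ℝ) / k :=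
      Finset.sum_nonneg fun k _ => by positivity
    have htop : ∑ k ∈ Finset.Ico (s - e) (s + 1), (1 : ℝ) / k =
        ∑ k ∈ Finset.Ico (s - e) s, (1 : ℝ) / k + 1 / s :=
      Finset.sum_Ico_succ_top (by omega) _
    simp only [contribution, activeInd, inactiveInd, Nat.cast_zero, add_zero, zero_mul, mul_zero,
      sub_zero, one_mul]
    rcases x.next_active i hc with ⟨h1, h⟩ | ⟨h1, h2, h⟩ | ⟨h1, h2, h⟩
    · rw [h, ind_true h1, ind_false (x.not_dataEmpty_of_succeedsFor i h1)]
      simp only [credit]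
      linarith
    · rw [ind_false h1, ind_true h2]
      rcases h with ⟨h3, h⟩ | ⟨h3, h⟩
      · rw [h]
        simp only [credit]
        have hlow : ((e : ℝ) + 1) * (1 / s) ≤ ∑ k ∈ Finset.Ico (s - e) (s + 1), (1 : ℝ) / k := by
          have hcard : (Finset.Ico (s - e) (s + 1)).card = e + 1 := by
            rw [Nat.card_Ico]; omega
          have := Finset.card_nsmul_le_sum (Finset.Ico (s - e) (s + 1)) (fun k : ℕ => (1 : ℝ) / k)
            (1 / s) (fun k hk => by
              rw [Finset.mem_Ico] at hk
              have h1 : (1 : ℝ) ≤ k := by exact_mod_cast (by omega : 1 ≤ k)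
              have h2 : (k : ℝ) ≤ s := by exact_mod_cast (by omega : k ≤ s)
              gcongr)
          rw [hcard, nsmul_eq_mul] at this
          exact_mod_cast this
        have h4 : (1 : ℝ) / 2 ≤ ((e : ℝ) + 1) * (1 / s) := by
          rw [mul_one_div, le_div_iff₀ hs0]
          have : (15 : ℝ) * s ≤ 16 * (e + 1) := by exact_mod_cast h3
          linarith
        linarith
      · rw [h]
        simp only [credit]
        rw [show s + 1 - (e + 1) = s - e by omega, htop]
        linarith
    · rw [ind_false h1, ind_false h2]
      rcases h with ⟨h3, h⟩ | ⟨h3, h⟩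
      · omega
      · rw [h]
        simp only [credit]
        -- The sum over `[s + 1 - e, s + 1)` arises from that over `[s - e, s)` by exchanging
        -- `1 / (s - e)` for the smaller `1 / s`.
        have hbot := Finset.sum_eq_sum_Ico_succ_bot (show s - e < s + 1 by omega)
          (fun k : ℕ => (1 : ℝ) / k)
        rw [htop, show s - e + 1 = s + 1 - e by omega] at hbot
        have h1 : (1 : ℝ) ≤ ((s - e : ℕ) : ℝ) := by exact_mod_cast (by omega : 1 ≤ s - e)
        have h2 : ((s - e : ℕ) : ℝ) ≤ s := by exact_mod_cast (by omega : s - e ≤ s)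
        have h5 : (1 : ℝ) / s ≤ 1 / ((s - e : ℕ) : ℝ) := by gcongr
        linarith

end Slot

/-! ### One slot, seen from the whole configuration -/

lemma contention_nonneg (σ : Config n) (τ : ℕ) : 0 ≤ contention σ τ :=
  Finset.sum_nonneg fun _ _ => contribution_nonneg _ _

lemma contention_anti {τ τ' : ℕ} (h : τ ≤ τ') {σ : Config n} (hσ : ∀ i, WellFormed (σ i)) :
    contention σ τ' ≤ contention σ τ :=
  Finset.sum_le_sum fun i _ => contribution_anti h (hσ i)

lemma sum_inactiveInd (σ : Config n) : ∑ i, inactiveInd (σ i) = inactiveCount σ := by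
  rw [inactiveCount, Finset.card_filter]
  push_cast
  refine Finset.sum_congr rfl fun i _ => ?_
  cases σ i <;> simp [inactiveInd]

lemma contention_le_div (σ : Config n) {τ : ℕ} (hτ : 0 < τ) : contention σ τ ≤ (n : ℝ) / τ := by
  have hτ' : (0 : ℝ) < τ := by exact_mod_cast hτ
  have : ∀ i ∈ Finset.univ, contribution τ (σ i) ≤ 1 / (τ : ℝ) := fun i _ => by
    cases σ i <;> simp only [contribution]
    case active s e => gcongr; linarith [s.cast_nonneg (α := ℝ)]
    all_goals positivity
  simpa [contention, div_eq_mul_inv] using Finset.sum_le_card_nsmul _ _ _ this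

lemma relaxTime_eq_zero {b : ℝ} {σ : Config n} (h : contention σ 0 ≤ b) : relaxTime b σ = 0 :=
  Nat.sInf_eq_zero.2 (Or.inl h)

lemma contention_relaxTime_le {b : ℝ} (hb : 1 ≤ b) (σ : Config n) :
    contention σ (relaxTime b σ) ≤ b := by
  refine Nat.sInf_mem (s := {τ | contention σ τ ≤ b}) ⟨n + 1, ?_⟩
  refine (contention_le_div σ n.succ_pos).trans (le_trans ?_ hb)
  push_cast
  rw [div_le_one (by positivity)]
  linarith

lemma contention_relapseTime_le {b : ℝ} (hb : 1 ≤ b) (σ : Config n) (h : inactiveCount σ ≠ 0) :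
    contention σ (relapseTime b σ + 1) + (inactiveCount σ : ℝ) / (relapseTime b σ + 1) ≤ b := by
  rw [relapseTime, if_neg h]
  refine Nat.sInf_mem (s := {τ : ℕ | contention σ (τ + 1) +
    (inactiveCount σ : ℝ) / (τ + 1) ≤ b}) ⟨n + inactiveCount σ, ?_⟩
  have h1 := contention_le_div σ (n + inactiveCount σ).succ_pos
  refine le_trans (add_le_add_left h1 _) (le_trans ?_ hb)
  push_cast
  rw [← add_div, div_le_one (by positivity)]
  linarith

lemma Slot.contention_next_le (x : Slot n) (τ : ℕ) :
    contention x.next τ ≤ contention x.config (τ + 1) +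
      (inactiveCount x.config : ℝ) * ind x.ControlEmpty / (τ + 1) := by
  refine (Finset.sum_le_sum fun i _ => x.contribution_next_le i τ).trans (le_of_eq ?_)
  rw [Finset.sum_add_distrib, ← Finset.sum_div, ← Finset.sum_mul, sum_inactiveInd, contention]

/-- The relaxation time falls by one per slot, except for a relapse at an activation. -/
lemma Slot.relaxTime_next_le {b : ℝ} (hb : 1 ≤ b) (x : Slot n)
    (hw : ∀ i, WellFormed (x.config i)) :
    (relaxTime b x.next : ℝ) ≤ relaxTime b x.config - ind (0 < relaxTime b x.config) +
      relapseTime b x.config * ind x.ControlEmpty := by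
  by_cases hA : inactiveCount x.config ≠ 0 ∧ x.ControlEmpty
  · have h1 : relaxTime b x.next ≤ relapseTime b x.config := by
      refine Nat.sInf_le ((x.contention_next_le _).trans ?_)
      rw [ind_true hA.2, mul_one]
      exact contention_relapseTime_le hb _ hA.1
    have h2 : ind (0 < relaxTime b x.config) ≤ (relaxTime b x.config : ℝ) := by
      by_cases h : 0 < relaxTime b x.config
      · rw [ind_true h]; exact_mod_cast h
      · rw [ind_false h]; positivity
    have h3 : (relaxTime b x.next : ℝ) ≤ relapseTime b x.config := by exact_mod_cast h1
    rw [ind_true hA.2]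
    linarith
  · have h0 : ∀ τ, contention x.next τ ≤ contention x.config (τ + 1) := fun τ => by
      refine (x.contention_next_le τ).trans (le_of_eq ?_)
      by_cases hA' : inactiveCount x.config = 0
      · simp [hA']
      · rw [ind_false (fun h => hA ⟨hA', h⟩)]; simp
    have h1 : relaxTime b x.next ≤ relaxTime b x.config - 1 := by
      refine Nat.sInf_le ((h0 _).trans (le_trans (contention_anti ?_ hw)
        (contention_relaxTime_le hb x.config)))
      omega
    have h2 : (0 : ℝ) ≤ relapseTime b x.config * ind x.ControlEmpty :=
      mul_nonneg (by positivity) (ind_nonneg _)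
    by_cases h : 0 < relaxTime b x.config
    · rw [ind_true h]
      have : ((relaxTime b x.next + 1 : ℕ) : ℝ) ≤ relaxTime b x.config := by
        exact_mod_cast (by omega : relaxTime b x.next + 1 ≤ relaxTime b x.config)
      push_cast at this
      linarith
    · rw [ind_false h]
      have : (relaxTime b x.next : ℝ) ≤ relaxTime b x.config := by
        exact_mod_cast h1.trans (Nat.sub_le _ _)
      linarith

/-- An empty data slot lowers the largest debt by one, any other slot raises it by at most `15`. -/
lemma Slot.maxDebt_next_le (x : Slot n) (hw : ∀ i, WellFormed (x.config i)) :
    (maxDebt x.next : ℝ) ≤ maxDebt x.config + 15 -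
      (15 + ind (0 < maxDebt x.config)) * ind x.DataEmpty := by
  have hle : ∀ i, debt (x.config i) ≤ maxDebt x.config := fun i =>
    Finset.le_sup (f := fun i => debt (x.config i)) (Finset.mem_univ i)
  by_cases hE : x.DataEmpty
  · have h1 : maxDebt x.next ≤ maxDebt x.config - 1 := Finset.sup_le fun i _ =>
      (x.debt_next_le_of_dataEmpty i (hw i) hE).trans (Nat.sub_le_sub_right (hle i) 1)
    rw [ind_true hE]
    by_cases h : 0 < maxDebt x.config
    · rw [ind_true h]
      have : ((maxDebt x.next + 1 : ℕ) : ℝ) ≤ maxDebt x.config := by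
        exact_mod_cast (by omega : maxDebt x.next + 1 ≤ maxDebt x.config)
      push_cast at this
      linarith
    · rw [ind_false h]
      have : (maxDebt x.next : ℝ) ≤ maxDebt x.config := by
        exact_mod_cast h1.trans (Nat.sub_le _ _)
      linarith
  · have h1 : maxDebt x.next ≤ maxDebt x.config + 15 := Finset.sup_le fun i _ =>
      (x.debt_next_le i (hw i)).trans (Nat.add_le_add_right (hle i) 15)
    rw [ind_false hE, mul_zero, sub_zero]
    exact_mod_cast h1

lemma Slot.sum_credit_next_le (x : Slot n) (hw : ∀ i, WellFormed (x.config i)) :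
    ∑ i, credit (x.next i) ≤ ∑ i, credit (x.config i) + contention x.config 0 * ind x.DataEmpty
      - 4 * ∑ i, activeInd (x.config i) * ind (x.SucceedsFor i)
      - 1 / 2 * (inactiveCount x.config * ind x.ControlEmpty) := by
  refine (Finset.sum_le_sum fun i _ => x.credit_next_le i (hw i)).trans (le_of_eq ?_)
  rw [Finset.sum_sub_distrib, Finset.sum_sub_distrib, Finset.sum_add_distrib, ← Finset.mul_sum,
    ← Finset.mul_sum, ← Finset.sum_mul, ← Finset.sum_mul, sum_inactiveInd, contention]

/-! ### Relapses are rare -/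

/-- A packet of age `s` causes much more contention on the control channel than it will cause on
the data channel `h` slots later. The cases are `√h ≤ s` and `s ≤ √h`. -/
lemma log_div_add_le {s h : ℝ} (hs : 1 ≤ s) (hh : 1 ≤ h) :
    Real.log h / 2 * (1 / (s + h)) ≤ max (Real.log s) 1 / s := by
  have hlog := Real.log_nonneg hh
  have hsq : Real.log h / 2 = Real.log √h := by rw [Real.log_sqrt (by linarith)]
  rcases le_total (√h) s with h1 | h1
  · have h2 : Real.log h / 2 ≤ max (Real.log s) 1 := by
      rw [hsq]
      exact (Real.log_le_log (by positivity) h1).trans (le_max_left _ _)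
    rw [mul_one_div]
    exact div_le_div₀ (by positivity) h2 (by linarith) (by linarith)
  · have h2 : Real.log h / 2 ≤ √h := by
      rw [hsq]
      linarith [Real.log_le_sub_one_of_pos (show 0 < √h by positivity)]
    have h3 : √h * √h = h := Real.mul_self_sqrt (by linarith)
    rw [mul_one_div, div_le_div_iff₀ (by linarith) (by linarith)]
    have h4 : Real.log h / 2 * s ≤ √h * √h := mul_le_mul h2 h1 (by linarith) (by positivity)
    have h5 : s + h ≤ max (Real.log s) 1 * (s + h) :=
      le_mul_of_one_le_left (by linarith) (le_max_right _ _)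
    linarith

lemma log_mul_contention_le {κ : ℝ} (hκ : 0 < κ) {σ : Config n} (hw : ∀ i, WellFormed (σ i))
    {h : ℕ} (hh : 1 ≤ h) :
    κ * (Real.log h / 2 * contention σ h) ≤ ∑ i, controlProb κ (σ i) := by
  rw [contention, Finset.mul_sum, Finset.mul_sum]
  refine Finset.sum_le_sum fun i _ => ?_
  have := hw i
  cases hc : σ i with
  | active s e =>
    rw [hc] at this
    simp only [contribution, controlProb]
    rw [mul_div_assoc]
    gcongr
    exact log_div_add_le (by exact_mod_cast this.1) (by exact_mod_cast hh)
  | _ => simp [contribution, controlProb]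

/-- If the control channel is empty with probability at most `exp (-∑ controlProb)`, then the
expected relapse is paid for by the number of activated packets, up to a small constant. If
activation would lead to a relapse time `h` that is large in comparison with the number of activated
packets, then the packets that are already active will cause contention at least `b / 2` after
`h` slots, hence cause so much contention on the control channel now that it is empty with
probability at most `1 / h ^ 2`. -/
lemma mul_relapseTime_le {κ b q : ℝ} (hκ : 0 < κ) (hb : 1 ≤ b) (hκb : 8 ≤ κ * b) {σ : Config n}
    (hw : ∀ i, WellFormed (σ i)) (hq0 : 0 ≤ q)
    (hq : q ≤ Real.exp (-∑ i, controlProb κ (σ i))) :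
    q * relapseTime b σ ≤ 256 * (inactiveCount σ * q) + 1 / 256 := by
  set A := inactiveCount σ with hA
  set h := relapseTime b σ with hh
  by_cases hA0 : A = 0
  · have : h = 0 := by rw [hh, relapseTime, ← hA, if_pos hA0]
    rw [this, hA0]; norm_num
  by_cases hle : h ≤ 256 * A
  · have : (h : ℝ) ≤ 256 * A := by exact_mod_cast hle
    nlinarith
  have hA1 : 1 ≤ A := Nat.one_le_iff_ne_zero.2 hA0
  have hnot : ¬ contention σ (h - 1 + 1) + (A : ℝ) / ((h - 1 : ℕ) + 1) ≤ b := by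
    have hlt : h - 1 < sInf {τ : ℕ | contention σ (τ + 1) + (A : ℝ) / (τ + 1) ≤ b} := by
      rw [hh, relapseTime, ← hA, if_neg hA0] at hle ⊢
      omega
    exact Nat.notMem_of_lt_sInf hlt
  rw [Nat.sub_add_cancel (by omega), Nat.cast_sub (by omega)] at hnot
  have hR : (256 : ℝ) * A < h := by exact_mod_cast not_le.1 hle
  have hA1' : (1 : ℝ) ≤ A := by exact_mod_cast hA1
  have hAh : (A : ℝ) / h ≤ 1 / 256 := by
    rw [div_le_div_iff₀ (by linarith) (by norm_num)]; linarith
  have hcont : b / 2 ≤ contention σ h := by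
    push_cast at hnot
    rw [sub_add_cancel] at hnot
    linarith
  have hlog : 0 ≤ Real.log h := Real.log_nonneg (by linarith)
  have hexp : 2 * Real.log h ≤ ∑ i, controlProb κ (σ i) := by
    refine le_trans ?_ (log_mul_contention_le hκ hw (h := h) (by omega))
    have h1 : κ * (Real.log h / 2 * (b / 2)) ≤ κ * (Real.log h / 2 * contention σ h) := by
      gcongr
    nlinarith
  have hq2 : q ≤ ((h : ℝ) ^ 2)⁻¹ := by
    refine hq.trans ((Real.exp_le_exp.2 (neg_le_neg hexp)).trans (le_of_eq ?_))
    rw [Real.exp_neg, two_mul, Real.exp_add, Real.exp_log (by linarith), sq]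
  have h3 : q * h ≤ 1 / 256 := by
    have h4 : q * h ≤ ((h : ℝ) ^ 2)⁻¹ * h := by gcongr
    refine h4.trans ?_
    rw [sq, mul_inv, mul_assoc, inv_mul_cancel₀ (by linarith), mul_one, inv_eq_one_div,
      div_le_div_iff₀ (by linarith) (by norm_num)]
    linarith
  have : 0 ≤ 256 * ((A : ℝ) * q) := by positivity
  linarith

/-! ### The random choices of one slot -/

/-- The distribution of the random numbers of one slot. -/
def slotMeasure (n : ℕ) : Measure (Fin n → unitInterval × unitInterval) :=
  Measure.pi fun _ => (volume : Measure unitInterval).prod (volume : Measure unitInterval)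

instance : IsProbabilityMeasure (slotMeasure n) := by unfold slotMeasure; infer_instance

lemma volume_real_lt {c : ℝ} (hc : 0 ≤ c) :
    (volume : Measure unitInterval).real {x | (x : ℝ) < c} = min c 1 := by
  by_cases h1 : c ≤ 1
  · have : {x : unitInterval | (x : ℝ) < c} = Set.Iio ⟨c, hc, h1⟩ := by
      ext x; simp [← Subtype.coe_lt_coe]
    rw [this, Measure.real, unitInterval.volume_Iio, ENNReal.toReal_ofReal hc, min_eq_left h1]
  · have : {x : unitInterval | (x : ℝ) < c} = Set.univ := by
      ext x; simpa using lt_of_le_of_lt x.2.2 (not_le.1 h1)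
    rw [this, min_eq_right (le_of_not_ge h1)]
    simp [Measure.real]

lemma measurableSet_fst_lt (c : ℝ) :
    MeasurableSet {z : unitInterval × unitInterval | (z.1 : ℝ) < c} :=
  measurableSet_lt (measurable_subtype_coe.comp measurable_fst) measurable_const

lemma measurableSet_snd_lt (c : ℝ) :
    MeasurableSet {z : unitInterval × unitInterval | (z.2 : ℝ) < c} :=
  measurableSet_lt (measurable_subtype_coe.comp measurable_snd) measurable_const

lemma prod_real_fst_lt {c : ℝ} (hc : 0 ≤ c) :
    ((volume : Measure unitInterval).prod (volume : Measure unitInterval)).real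
      {z | (z.1 : ℝ) < c} = min c 1 := by
  have : {z : unitInterval × unitInterval | (z.1 : ℝ) < c} =
      {x : unitInterval | (x : ℝ) < c} ×ˢ Set.univ := by
    ext z; simp
  rw [this, measureReal_prod_prod, volume_real_lt hc]
  simp [Measure.real]

lemma prod_real_snd_lt {c : ℝ} (hc : 0 ≤ c) :
    ((volume : Measure unitInterval).prod (volume : Measure unitInterval)).real
      {z | (z.2 : ℝ) < c} = min c 1 := by
  have : {z : unitInterval × unitInterval | (z.2 : ℝ) < c} =
      Set.univ ×ˢ {x : unitInterval | (x : ℝ) < c} := by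
    ext z; simp
  rw [this, measureReal_prod_prod, volume_real_lt hc]
  simp [Measure.real]

/-- The probability that exactly the packets in `S` broadcast. -/
lemma slotMeasure_real_forall_iff {B : Fin n → Set (unitInterval × unitInterval)}
    (hB : ∀ i, MeasurableSet (B i)) (S : Finset (Fin n)) :
    (slotMeasure n).real {u | ∀ i, u i ∈ B i ↔ i ∈ S} =
      ∏ i, if i ∈ S then ((volume : Measure unitInterval).prod volume).real (B i)
        else 1 - ((volume : Measure unitInterval).prod volume).real (B i) := by
  have : {u : Fin n → unitInterval × unitInterval | ∀ i, u i ∈ B i ↔ i ∈ S} =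
      Set.univ.pi fun i => if i ∈ S then B i else (B i)ᶜ := by
    ext u
    simp only [Set.mem_ofPred_eq, Set.mem_univ_pi]
    refine forall_congr' fun i => ?_
    by_cases h : i ∈ S <;> simp [h]
  rw [this, Measure.real, slotMeasure, Measure.pi_pi, ENNReal.toReal_prod]
  refine Finset.prod_congr rfl fun i _ => ?_
  by_cases h : i ∈ S
  · simp [h, Measure.real]
  · simp only [h, if_false]
    exact probReal_compl_eq_one_sub (hB i)

section OneSlot

variable (κ : ℝ) (σ : Config n) (a : Action n)

lemma measurableSet_senders (D C : Finset (Fin n)) :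
    MeasurableSet {u | (playSlot κ σ a u).dataSenders = D ∧
      (playSlot κ σ a u).controlSenders = C} := by
  have h1 : ∀ i, MeasurableSet {u : Fin n → unitInterval × unitInterval |
      ((u i).1 : ℝ) < dataProb (σ i)} := fun i =>
    (measurable_pi_apply (X := fun _ => unitInterval × unitInterval) i)
      (measurableSet_fst_lt (dataProb (σ i)))
  have h2 : ∀ i, MeasurableSet {u : Fin n → unitInterval × unitInterval |
      ((u i).2 : ℝ) < controlProb κ (σ i)} := fun i =>
    (measurable_pi_apply (X := fun _ => unitInterval × unitInterval) i)
      (measurableSet_snd_lt (controlProb κ (σ i)))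
  simp only [playSlot, Finset.ext_iff, Finset.mem_filter, Finset.mem_univ, true_and]
  exact (measurableSet_setOfPred.2 (Measurable.forall fun i =>
    (measurableSet_setOfPred.1 (h1 i)).iff measurable_const)).inter
    (measurableSet_setOfPred.2 (Measurable.forall fun i =>
      (measurableSet_setOfPred.1 (h2 i)).iff measurable_const))

/-- Every function of the outcome of a slot is measurable, as there are finitely many outcomes. -/
lemma measurable_comp_playSlot {β : Type*} [MeasurableSpace β] (g : Slot n → β) :
    Measurable fun u => g (playSlot κ σ a u) := by
  intro T _
  have : (fun u => g (playSlot κ σ a u)) ⁻¹' T =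
      ⋃ D, ⋃ C, ⋃ (_ : g ⟨σ, a, D, C⟩ ∈ T), {u | (playSlot κ σ a u).dataSenders = D ∧
        (playSlot κ σ a u).controlSenders = C} := by
    ext u
    simp only [Set.mem_preimage, Set.mem_iUnion, Set.mem_ofPred_eq, exists_prop]
    constructor
    · intro h
      exact ⟨_, _, h, rfl, rfl⟩
    · rintro ⟨D, C, h, rfl, rfl⟩
      exact h
  rw [this]
  exact MeasurableSet.iUnion fun D => MeasurableSet.iUnion fun C => MeasurableSet.iUnion fun _ =>
    measurableSet_senders κ σ a D C

lemma integrable_comp_playSlot (g : Slot n → ℝ) :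
    Integrable (fun u => g (playSlot κ σ a u)) (slotMeasure n) := by
  obtain ⟨M, hM⟩ := isBounded_iff_forall_norm_le.1
    (Set.finite_range fun q : Finset (Fin n) × Finset (Fin n) => g ⟨σ, a, q.1, q.2⟩).isBounded
  exact Integrable.of_bound (measurable_comp_playSlot κ σ a g).aestronglyMeasurable M
    (Filter.Eventually.of_forall fun u => hM _ ⟨((playSlot κ σ a u).dataSenders,
      (playSlot κ σ a u).controlSenders), rfl⟩)

/-- The probability of an event that concerns one slot. -/
def slotProb (P : Slot n → Prop) : ℝ := ∫ u, ind (P (playSlot κ σ a u)) ∂slotMeasure n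

lemma slotProb_nonneg (P : Slot n → Prop) : 0 ≤ slotProb κ σ a P :=
  integral_nonneg fun _ => ind_nonneg _

lemma slotProb_eq (P : Slot n → Prop) :
    slotProb κ σ a P = (slotMeasure n).real {u | P (playSlot κ σ a u)} := by
  have hm : MeasurableSet {u | P (playSlot κ σ a u)} :=
    measurableSet_setOfPred.2 (measurable_comp_playSlot κ σ a P)
  rw [← integral_indicator_one hm, slotProb]
  refine integral_congr_ae (Filter.Eventually.of_forall fun u => ?_)
  by_cases h : P (playSlot κ σ a u) <;> simp [ind, h]

lemma slotProb_eq_zero {P : Slot n → Prop} (h : ∀ u, ¬ P (playSlot κ σ a u)) :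
    slotProb κ σ a P = 0 := by
  simp [slotProb_eq, h]

variable {κ σ a}

lemma dataProb_nonneg (p : PacketState) : 0 ≤ dataProb p := by
  rw [dataProb_eq]; linarith [contribution_nonneg 0 p]

lemma dataProb_le {p : PacketState} : dataProb p ≤ 1 / 2 := by
  cases p <;> simp only [dataProb, dConst]
  case active s e =>
    rcases Nat.eq_zero_or_pos s with rfl | h
    · simp
    · have : (1 : ℝ) ≤ s := by exact_mod_cast h
      exact div_le_self (by norm_num) this
  all_goals norm_num

lemma controlProb_nonneg (hκ : 0 < κ) (p : PacketState) : 0 ≤ controlProb κ p := by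
  cases p <;> simp only [controlProb] <;> positivity

lemma slotProb_dataSenders (S : Finset (Fin n)) :
    slotProb κ σ a (fun x => x.dataSenders = S) =
      ∏ i, if i ∈ S then dataProb (σ i) else 1 - dataProb (σ i) := by
  have := slotMeasure_real_forall_iff (fun i => measurableSet_fst_lt (dataProb (σ i))) S
  simp only [prod_real_fst_lt (dataProb_nonneg _),
    min_eq_left (dataProb_le.trans (by norm_num : (1 : ℝ) / 2 ≤ 1))] at this
  rw [slotProb_eq, ← this]
  simp [playSlot, Finset.ext_iff]

lemma slotProb_controlSenders_eq_empty (hκ : 0 < κ) :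
    slotProb κ σ a (fun x => x.controlSenders = ∅) = ∏ i, (1 - min (controlProb κ (σ i)) 1) := by
  have := slotMeasure_real_forall_iff (fun i => measurableSet_snd_lt (controlProb κ (σ i))) ∅
  simp only [prod_real_snd_lt (controlProb_nonneg hκ _), Finset.notMem_empty, if_false] at this
  rw [slotProb_eq, ← this]
  simp [playSlot, Finset.ext_iff]

lemma slotProb_dataEmpty (ha : a.jamData = false) :
    slotProb κ σ a Slot.DataEmpty = ∏ i, (1 - dataProb (σ i)) := by
  have : slotProb κ σ a Slot.DataEmpty = slotProb κ σ a (fun x => x.dataSenders = ∅) := by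
    simp [slotProb, Slot.DataEmpty, playSlot, ha]
  rw [this, slotProb_dataSenders]
  simp

lemma exp_neg_two_mul_le {p : ℝ} (h0 : 0 ≤ p) (h1 : p ≤ 1 / 2) :
    Real.exp (-(2 * p)) ≤ 1 - p := by
  rw [Real.exp_neg, inv_le_comm₀ (Real.exp_pos _) (by linarith)]
  refine le_trans ?_ (Real.add_one_le_exp (2 * p))
  rw [inv_eq_one_div, div_le_iff₀ (by linarith)]
  nlinarith

lemma exp_neg_contention_le (ha : a.jamData = false) :
    Real.exp (-contention σ 0) ≤ slotProb κ σ a Slot.DataEmpty := by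
  rw [slotProb_dataEmpty ha, contention, ← Finset.sum_neg_distrib, Real.exp_sum]
  refine Finset.prod_le_prod (fun _ _ => (Real.exp_pos _).le) fun i _ => ?_
  have := exp_neg_two_mul_le (dataProb_nonneg (σ i)) dataProb_le
  rwa [show 2 * dataProb (σ i) = contribution 0 (σ i) by rw [dataProb_eq]; ring] at this

/-- A packet succeeds if it broadcasts and nobody else does, which is at least as likely as that it
broadcasts and, independently, nobody at all does. -/
lemma mul_slotProb_dataEmpty_le (i : Fin n) :
    dataProb (σ i) * slotProb κ σ a Slot.DataEmpty ≤
      slotProb κ σ a (fun x => x.SucceedsFor i) := by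
  cases ha : a.jamData with
  | true =>
    rw [slotProb_eq_zero κ σ a (P := Slot.DataEmpty) (by simp [Slot.DataEmpty, playSlot, ha]),
      mul_zero]
    exact slotProb_nonneg _ _ _ _
  | false =>
    have : slotProb κ σ a (fun x => x.SucceedsFor i) =
        slotProb κ σ a (fun x => x.dataSenders = {i}) := by
      simp [slotProb, Slot.SucceedsFor, playSlot, ha]
    have h1 : ∀ j, 0 ≤ 1 - dataProb (σ j) := fun j => by linarith [dataProb_le (p := σ j)]
    rw [this, slotProb_dataSenders, slotProb_dataEmpty ha,
      ← Finset.mul_prod_erase _ _ (Finset.mem_univ i),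
      ← Finset.mul_prod_erase _ (fun j => if j ∈ ({i} : Finset (Fin n)) then dataProb (σ j)
        else 1 - dataProb (σ j)) (Finset.mem_univ i)]
    have h2 : ∏ j ∈ Finset.univ.erase i, (if j ∈ ({i} : Finset (Fin n)) then dataProb (σ j)
        else 1 - dataProb (σ j)) = ∏ j ∈ Finset.univ.erase i, (1 - dataProb (σ j)) := by
      refine Finset.prod_congr rfl fun j hj => ?_
      simp [Finset.ne_of_mem_erase hj]
    rw [h2]
    simp only [Finset.mem_singleton, if_true]
    have h3 : 0 ≤ ∏ j ∈ Finset.univ.erase i, (1 - dataProb (σ j)) :=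
      Finset.prod_nonneg fun j _ => h1 j
    have h4 := dataProb_nonneg (σ i)
    exact mul_le_mul_of_nonneg_left (mul_le_of_le_one_left h3 (by linarith)) h4

lemma slotProb_controlEmpty (hκ : 0 < κ) (ha : a.jamControl = false) :
    slotProb κ σ a Slot.ControlEmpty = ∏ i, (1 - min (controlProb κ (σ i)) 1) := by
  rw [← slotProb_controlSenders_eq_empty (a := a) hκ]
  simp [slotProb, Slot.ControlEmpty, playSlot, ha]

lemma slotProb_controlEmpty_le (hκ : 0 < κ) :
    slotProb κ σ a Slot.ControlEmpty ≤ Real.exp (-∑ i, controlProb κ (σ i)) := by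
  cases ha : a.jamControl with
  | true =>
    rw [slotProb_eq_zero κ σ a (P := Slot.ControlEmpty) (by simp [Slot.ControlEmpty, playSlot, ha])]
    positivity
  | false =>
    rw [slotProb_controlEmpty hκ ha, ← Finset.sum_neg_distrib, Real.exp_sum]
    refine Finset.prod_le_prod (fun i _ => by linarith [min_le_right (controlProb κ (σ i)) 1])
      fun i _ => ?_
    rcases min_cases (controlProb κ (σ i)) 1 with ⟨h, -⟩ | ⟨h, -⟩ <;> rw [h]
    · exact Real.one_sub_le_exp_neg _
    · rw [sub_self]; positivity

/-! ### The drift of the potential -/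

/-- The potential. The factor of the credit is so large that the credit released by a success or
by an activation pays for everything that may happen to the other two parts meanwhile. -/
def potential (b : ℝ) (σ : Config n) : ℝ :=
  maxDebt σ + 32 * relaxTime b σ + 32768 * Real.exp b * ∑ i, credit (σ i)

lemma potential_nonneg (b : ℝ) (σ : Config n) : 0 ≤ potential b σ := by
  have : 0 ≤ ∑ i, credit (σ i) := Finset.sum_nonneg fun i _ => credit_nonneg _
  unfold potential
  positivity

/-- The configuration during a slot, after the arrivals. -/
def arrive (σ : Config n) (a : Action n) : Config n := fun i =>
  if σ i = .notArrived ∧ i ∈ a.arrivals then .inactive else σ i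

lemma config_playSlot (u : Fin n → unitInterval × unitInterval) :
    (playSlot κ σ a u).config = arrive σ a := rfl

lemma apply_arrive {β : Type*} (f : PacketState → β) (hf : f .inactive = f .notArrived)
    (i : Fin n) : f (arrive σ a i) = f (σ i) := by
  unfold arrive
  split_ifs with h
  · rw [hf, h.1]
  · rfl

lemma wellFormed_arrive (hw : ∀ i, WellFormed (σ i)) (i : Fin n) : WellFormed (arrive σ a i) :=
  (apply_arrive WellFormed rfl i).symm ▸ hw i

lemma contention_arrive (τ : ℕ) : contention (arrive σ a) τ = contention σ τ :=
  Finset.sum_congr rfl fun i _ => apply_arrive (contribution τ) rfl i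

lemma potential_arrive (b : ℝ) : potential b (arrive σ a) = potential b σ := by
  simp only [potential, maxDebt, relaxTime, contention_arrive, apply_arrive credit rfl,
    apply_arrive debt rfl]

variable (κ σ a) in
/-- The expected change of the potential in terms of the probabilities of the events that matter. -/
lemma integral_potential_next_le {b : ℝ} (hb : 1 ≤ b) (hw : ∀ i, WellFormed (σ i)) :
    ∫ u, potential b (playSlot κ σ a u).next ∂slotMeasure n ≤
      potential b σ + (15 - (15 + ind (0 < maxDebt (arrive σ a))) *
          slotProb κ σ a Slot.DataEmpty)
        + 32 * (relapseTime b (arrive σ a) * slotProb κ σ a Slot.ControlEmpty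
            - ind (0 < relaxTime b (arrive σ a)))
        + 32768 * Real.exp b * (contention σ 0 * slotProb κ σ a Slot.DataEmpty
          - 4 * ∑ i, activeInd (σ i) * slotProb κ σ a (fun x => x.SucceedsFor i)
          - 1 / 2 * (inactiveCount (arrive σ a) * slotProb κ σ a Slot.ControlEmpty)) := by
  set ρ := arrive σ a with hρ
  have hint : ∀ P : Slot n → Prop, Integrable (fun u => ind (P (playSlot κ σ a u)))
      (slotMeasure n) := fun P => integrable_comp_playSlot κ σ a fun x => ind (P x)
  have hsum : ∑ i, activeInd (σ i) * slotProb κ σ a (fun x => x.SucceedsFor i) =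
      ∫ u, ∑ i, activeInd (σ i) * ind ((playSlot κ σ a u).SucceedsFor i) ∂slotMeasure n := by
    rw [integral_finsetSum _ fun i _ => (hint fun x => x.SucceedsFor i).const_mul _]
    exact Finset.sum_congr rfl fun i _ => (integral_const_mul _ _).symm
  have hpt : ∀ u, potential b (playSlot κ σ a u).next ≤
      potential b σ + 15 - 32 * ind (0 < relaxTime b ρ) +
      (32768 * Real.exp b * contention σ 0 - (15 + ind (0 < maxDebt ρ))) *
        ind (playSlot κ σ a u).DataEmpty +
      (32 * relapseTime b ρ - 32768 * Real.exp b * (1 / 2 * inactiveCount ρ)) *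
        ind (playSlot κ σ a u).ControlEmpty -
      32768 * Real.exp b * 4 *
        ∑ i, activeInd (σ i) * ind ((playSlot κ σ a u).SucceedsFor i) := by
    intro u
    have hwρ : ∀ i, WellFormed ((playSlot κ σ a u).config i) := wellFormed_arrive hw
    have h1 := (playSlot κ σ a u).maxDebt_next_le hwρ
    have h2 := (playSlot κ σ a u).relaxTime_next_le hb hwρ
    have h3 := (playSlot κ σ a u).sum_credit_next_le hwρ
    rw [config_playSlot, ← hρ] at h1 h2 h3
    have h4 : ∑ i, activeInd (ρ i) * ind ((playSlot κ σ a u).SucceedsFor i) =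
        ∑ i, activeInd (σ i) * ind ((playSlot κ σ a u).SucceedsFor i) :=
      Finset.sum_congr rfl fun i _ => by rw [hρ, apply_arrive activeInd rfl]
    have h5 : contention ρ 0 = contention σ 0 := contention_arrive 0
    rw [h4, h5] at h3
    have h6 := mul_le_mul_of_nonneg_left h3
      (show 0 ≤ 32768 * Real.exp b by positivity)
    rw [← potential_arrive (σ := σ) (a := a), ← hρ]
    unfold potential
    linarith
  refine (integral_mono (integrable_comp_playSlot κ σ a fun x => potential b x.next)
    (integrable_comp_playSlot κ σ a fun x =>
      potential b σ + 15 - 32 * ind (0 < relaxTime b ρ) +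
      (32768 * Real.exp b * contention σ 0 - (15 + ind (0 < maxDebt ρ))) * ind x.DataEmpty +
      (32 * relapseTime b ρ - 32768 * Real.exp b * (1 / 2 * inactiveCount ρ)) *
        ind x.ControlEmpty -
      32768 * Real.exp b * 4 * ∑ i, activeInd (σ i) * ind (x.SucceedsFor i)) hpt).trans
    (le_of_eq ?_)
  have hS : Integrable (fun u => ∑ i, activeInd (σ i) * ind ((playSlot κ σ a u).SucceedsFor i))
      (slotMeasure n) :=
    integrable_comp_playSlot κ σ a fun x => ∑ i, activeInd (σ i) * ind (x.SucceedsFor i)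
  rw [integral_sub, integral_add, integral_add, integral_const, integral_const_mul,
    integral_const_mul, integral_const_mul, hsum]
  · simp only [probReal_univ, slotProb, one_smul]
    ring
  · exact integrable_const _
  · exact (hint _).const_mul _
  · exact (integrable_const _).add ((hint _).const_mul _)
  · exact (hint _).const_mul _
  · exact ((integrable_const _).add ((hint _).const_mul _)).add ((hint _).const_mul _)
  · exact hS.const_mul _

/-- If no packet is in debt and the contention is small, then no packet is active. -/
lemma ne_active_of_maxDebt_eq_zero (hw : ∀ i, WellFormed (σ i)) (hd : maxDebt σ = 0)
    (hc : contention σ 0 < 1) (i : Fin n) (s e : ℕ) : σ i ≠ .active s e := by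
  intro h
  have h1 : debt (σ i) ≤ maxDebt σ :=
    Finset.le_sup (f := fun i => debt (σ i)) (Finset.mem_univ i)
  have h2 := hw i
  have h3 : contribution 0 (σ i) ≤ contention σ 0 :=
    Finset.single_le_sum (f := fun i => contribution 0 (σ i))
      (fun j _ => contribution_nonneg 0 _) (Finset.mem_univ i)
  rw [h] at h1 h2 h3
  simp only [debt, WellFormed, contribution] at h1 h2 h3
  obtain rfl : s = 1 := by omega
  norm_num at h3
  linarith

/-- In a slot with a live packet, the potential falls in expectation, unless the slot is
disrupted. If the contention exceeds `b`, then the relaxation time falls. If the contention is of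
constant order, then some packet succeeds with constant probability. If the contention is
smaller, then the data channel is empty with probability close to `1`, so that the debt falls, and
if there is no debt, then nobody is active and all inactive packets are activated. -/
lemma integral_potential_next_le_sub {b : ℝ} (hκ : 0 < κ) (hb : 1 ≤ b) (hκb : 8 ≤ κ * b)
    (hw : ∀ i, WellFormed (σ i)) (hlive : ∃ i, (arrive σ a i).Live) :
    ∫ u, potential b (playSlot κ σ a u).next ∂slotMeasure n ≤
      potential b σ - 1 / 4 + 17 * ind (a.jamData = true ∨ a.jamControl = true) := by
  refine (integral_potential_next_le κ σ a hb hw).trans ?_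
  have hwρ := wellFormed_arrive (a := a) hw
  have hp0 : 0 ≤ slotProb κ σ a Slot.DataEmpty := slotProb_nonneg _ _ _ _
  have hq0 : 0 ≤ slotProb κ σ a Slot.ControlEmpty := slotProb_nonneg _ _ _ _
  have hcontrol : ∑ i, controlProb κ (arrive σ a i) = ∑ i, controlProb κ (σ i) :=
    Finset.sum_congr rfl fun i _ => apply_arrive (controlProb κ) rfl i
  have hrelapse := mul_relapseTime_le (σ := arrive σ a) hκ hb hκb hwρ hq0
    (hcontrol ▸ slotProb_controlEmpty_le (a := a) hκ)
  have hsucc : contention σ 0 * slotProb κ σ a Slot.DataEmpty ≤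
      2 * ∑ i, activeInd (σ i) * slotProb κ σ a (fun x => x.SucceedsFor i) := by
    rw [contention, Finset.sum_mul, Finset.mul_sum]
    refine Finset.sum_le_sum fun i _ => ?_
    have := mul_slotProb_dataEmpty_le (κ := κ) (σ := σ) (a := a) i
    rw [dataProb_eq] at this
    cases h : σ i with
    | active s e =>
      rw [h] at this
      simp only [activeInd]
      linarith
    | _ => simp [contribution, activeInd]
  have hexp : 1 ≤ Real.exp b := Real.one_le_exp (by linarith)
  have hAq : 0 ≤ (inactiveCount (arrive σ a) : ℝ) * slotProb κ σ a Slot.ControlEmpty := by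
    positivity
  have hX0 : 0 ≤ contention σ 0 := contention_nonneg σ 0
  have hXp : 0 ≤ contention σ 0 * slotProb κ σ a Slot.DataEmpty := by positivity
  have hη := ind_nonneg (0 < relaxTime b (arrive σ a))
  have hdebt := ind_nonneg (0 < maxDebt (arrive σ a))
  have hη' : contention σ 0 > b → ind (0 < relaxTime b (arrive σ a)) = 1 := fun h => by
    refine ind_true (Nat.pos_of_ne_zero fun h0 => ?_)
    have := contention_relaxTime_le hb (arrive σ a)
    rw [h0, contention_arrive] at this
    linarith
  have hp : a.jamData = false → Real.exp (-contention σ 0) ≤ slotProb κ σ a Slot.DataEmpty :=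
    fun h => exp_neg_contention_le h
  have hidle : a.jamControl = false → contention σ 0 < 1 / 32 → maxDebt (arrive σ a) = 0 →
      contention σ 0 = 0 ∧
        1 ≤ (inactiveCount (arrive σ a) : ℝ) * slotProb κ σ a Slot.ControlEmpty := by
    intro ha hc hd
    have hna := ne_active_of_maxDebt_eq_zero hwρ hd
      (by rw [contention_arrive]; linarith)
    have hna' : ∀ i s e, σ i ≠ .active s e := fun i s e h => by
      refine hna i s e ?_
      simp [arrive, h]
    have hq : slotProb κ σ a Slot.ControlEmpty = 1 := by
      rw [slotProb_controlEmpty hκ ha]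
      refine Finset.prod_eq_one fun i _ => ?_
      cases h : σ i with
      | active s e => exact absurd h (hna' i s e)
      | _ => simp [controlProb]
    constructor
    · refine Finset.sum_eq_zero fun i _ => ?_
      cases h : σ i with
      | active s e => exact absurd h (hna' i s e)
      | _ => simp [contribution]
    · rw [hq, mul_one]
      obtain ⟨i, hi⟩ := hlive
      have : 0 < inactiveCount (arrive σ a) := by
        refine Finset.card_pos.2 ⟨i, Finset.mem_filter.2 ⟨Finset.mem_univ i, ?_⟩⟩
        cases h : arrive σ a i with
        | active s e => exact absurd h (hna i s e)
        | inactive => rfl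
        | notArrived => rw [h] at hi; exact hi.elim
        | finished => rw [h] at hi; exact hi.elim
      exact_mod_cast this
  set p := slotProb κ σ a Slot.DataEmpty
  set q := slotProb κ σ a Slot.ControlEmpty
  set J := (relapseTime b (arrive σ a) : ℝ)
  set A := (inactiveCount (arrive σ a) : ℝ)
  set S := ∑ i, activeInd (σ i) * slotProb κ σ a (fun x => x.SucceedsFor i)
  set X := contention σ 0
  have hbound : 32768 * Real.exp b * (X * p - 4 * S - 1 / 2 * (A * q)) ≤
      -(32768 * Real.exp b * (X * p)) - 16384 * (A * q) := by
    nlinarith [mul_nonneg (sub_nonneg.2 hexp) hAq, mul_nonneg (Real.exp_pos b).le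
      (sub_nonneg.2 hsucc)]
  have hdp := mul_nonneg hdebt hp0
  have hKXp : 0 ≤ Real.exp b * (X * p) := by positivity
  by_cases hjam : a.jamData = true ∨ a.jamControl = true
  · rw [ind_true hjam]
    nlinarith
  rw [ind_false hjam]
  rw [not_or, Bool.not_eq_true, Bool.not_eq_true] at hjam
  have hp := hp hjam.1
  rcases lt_or_ge b X with hX | hX
  · rw [hη' hX] at *
    nlinarith
  rcases lt_or_ge X (1 / 32) with hX' | hX'
  · have hp1 : 1 - X ≤ p := by linarith [Real.add_one_le_exp (-X)]
    rcases Nat.eq_zero_or_pos (maxDebt (arrive σ a)) with hd | hd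
    · obtain ⟨h1, h2⟩ := hidle hjam.2 hX' hd
      rw [ind_false (by omega)]
      nlinarith
    · rw [ind_true hd]
      nlinarith
  · have h1 : Real.exp (-b) ≤ p := (Real.exp_le_exp.2 (by linarith)).trans hp
    have h2 : 1 ≤ Real.exp b * p := by
      have := mul_le_mul_of_nonneg_left h1 (Real.exp_pos b).le
      rwa [← Real.exp_add, add_neg_cancel, Real.exp_zero] at this
    have h3 : 1 / 32 ≤ Real.exp b * (X * p) := by
      rw [mul_left_comm]
      nlinarith
    nlinarith

/-- Nothing changes in a slot without a live packet. -/
lemma next_eq_of_not_live (hlive : ¬ ∃ i, (arrive σ a i).Live)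
    (u : Fin n → unitInterval × unitInterval) : (playSlot κ σ a u).next = arrive σ a := by
  funext i
  have hi : ¬ (arrive σ a i).Live := fun h => hlive ⟨i, h⟩
  cases h : arrive σ a i with
  | active s e => exact absurd (by rw [h]; trivial) hi
  | inactive => exact absurd (by rw [h]; trivial) hi
  | notArrived => exact (playSlot κ σ a u).next_notArrived i h
  | finished => exact (playSlot κ σ a u).next_finished i h

end OneSlot

/-! ### The execution as a random process -/

instance : Countable PacketState := by
  let f : PacketState → Bool × Option (ℕ × ℕ) × Unit
    | .notArrived => (false, none, ())
    | .inactive => (true, none, ())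
    | .active s e => (true, some (s, e), ())
    | .finished => (false, some (0, 0), ())
  refine Function.Injective.countable (f := f) fun p q h => ?_
  cases p <;> cases q <;> simp_all [f]

instance : Countable (Action n) :=
  Function.Injective.countable (f := fun a : Action n => (a.arrivals, a.jamData, a.jamControl))
    fun a b h => by cases a; cases b; simp_all

instance : Countable (Slot n) :=
  Function.Injective.countable
    (f := fun x : Slot n => (x.start, x.action, x.dataSenders, x.controlSenders))
    fun a b h => by cases a; cases b; simp_all

/-- There are only countably many histories, and all sets of histories are measurable. -/
instance : MeasurableSpace (List (Slot n) × Config n) := ⊤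

instance : DiscreteMeasurableSpace (List (Slot n) × Config n) := ⟨fun _ => trivial⟩

instance : IsProbabilityMeasure (coinMeasure n) := by unfold coinMeasure; infer_instance

variable (κ : ℝ) (A : Adversary n)

/-- The slot that results from a history and the random numbers of the slot. -/
def slotAfter (h : List (Slot n) × Config n) (u : Fin n → unitInterval × unitInterval) : Slot n :=
  playSlot κ h.2 (A h.1 h.2) u

lemma slotAt_eq (ω : Coins n) (t : ℕ) :
    slotAt κ A ω t = slotAfter κ A (run κ A ω t) (ω t) := rfl

lemma run_succ (ω : Coins n) (t : ℕ) :
    run κ A ω (t + 1) = (slotAt κ A ω t :: (run κ A ω t).1, (slotAt κ A ω t).next) := rfl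

lemma measurable_slotAfter {β : Type*} [MeasurableSpace β]
    (g : List (Slot n) × Config n → Slot n → β) :
    Measurable fun p : (List (Slot n) × Config n) × (Fin n → unitInterval × unitInterval) =>
      g p.1 (slotAfter κ A p.1 p.2) :=
  measurable_from_prod_countable_right fun h =>
    measurable_comp_playSlot κ h.2 (A h.1 h.2) (g h)

lemma measurable_run (t : ℕ) : Measurable fun ω => run κ A ω t := by
  induction t with
  | zero => exact measurable_const
  | succ t ih =>
    exact (measurable_slotAfter κ A fun h x => (x :: h.1, x.next)).comp
      (ih.prodMk (measurable_pi_apply t))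

lemma measurable_comp_slotAt {β : Type*} [MeasurableSpace β] (g : Slot n → β) (t : ℕ) :
    Measurable fun ω => g (slotAt κ A ω t) :=
  (measurable_slotAfter κ A fun _ x => g x).comp
    ((measurable_run κ A t).prodMk (measurable_pi_apply t))

/-- The random numbers of the first `t` slots, continued arbitrarily. -/
def extendCoins (t : ℕ) (v : Finset.range t → Fin n → unitInterval × unitInterval) : Coins n :=
  fun s => if h : s ∈ Finset.range t then v ⟨s, h⟩ else fun _ => (0, 0)

lemma measurable_extendCoins (t : ℕ) : Measurable (extendCoins (n := n) t) := by
  refine measurable_pi_lambda _ fun s => ?_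
  by_cases h : s ∈ Finset.range t
  · simpa [extendCoins, h] using measurable_pi_apply _
  · simp [extendCoins, h]

lemma run_congr {ω ω' : Coins n} {t : ℕ} (h : ∀ s < t, ω s = ω' s) :
    run κ A ω t = run κ A ω' t := by
  induction t with
  | zero => rfl
  | succ t ih =>
    have ih := ih fun s hs => h s (by omega)
    simp only [run_succ, slotAt_eq, ih, h t (by omega)]

/-- The history before slot `t` is independent of the random choices in slot `t`. -/
lemma indepFun_run (t : ℕ) :
    ProbabilityTheory.IndepFun (fun ω => run κ A ω t) (fun ω => ω t) (coinMeasure n) := by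
  have h1 : ProbabilityTheory.iIndepFun (fun (s : ℕ) (ω : Coins n) => ω s) (coinMeasure n) :=
    ProbabilityTheory.iIndepFun_infinitePi
      (X := fun (_ : ℕ) (u : Fin n → unitInterval × unitInterval) => u)
      (fun _ => measurable_id)
  have h2 := h1.indepFun_finset (Finset.range t) {t} (by simp) fun s => measurable_pi_apply s
  have h3 : Measurable fun v : (({t} : Finset ℕ) → Fin n → unitInterval × unitInterval) =>
      v ⟨t, by simp⟩ := measurable_pi_apply _
  have h4 := h2.comp ((measurable_run κ A t).comp (measurable_extendCoins t)) h3
  convert h4 using 1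
  · funext ω
    exact run_congr κ A fun s hs => by simp [extendCoins, hs]
  · rfl

/-- Averaging over the random choices of slot `t` first. -/
lemma lintegral_slotAt (g : Slot n → ℝ≥0∞) (t : ℕ) :
    ∫⁻ ω, g (slotAt κ A ω t) ∂coinMeasure n =
      ∫⁻ ω, ∫⁻ u, g (slotAfter κ A (run κ A ω t) u) ∂slotMeasure n ∂coinMeasure n := by
  have hm := measurable_slotAfter κ A fun _ x => g x
  have hr := measurable_run κ A t
  have he : Measurable fun ω : Coins n => ω t := measurable_pi_apply t
  have hmap : (coinMeasure n).map (fun ω => ω t) = slotMeasure n :=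
    Measure.infinitePi_map_eval _ t
  calc ∫⁻ ω, g (slotAt κ A ω t) ∂coinMeasure n
      = ∫⁻ p, g (slotAfter κ A p.1 p.2) ∂(coinMeasure n).map fun ω => (run κ A ω t, ω t) :=
        (lintegral_map hm (hr.prodMk he)).symm
    _ = ∫⁻ h, ∫⁻ u, g (slotAfter κ A h u) ∂slotMeasure n
          ∂(coinMeasure n).map fun ω => run κ A ω t := by
        rw [(indepFun_run κ A t).map_prod_eq_prod_map_map hr.aemeasurable he.aemeasurable, hmap,
          lintegral_prod _ hm.aemeasurable]
    _ = _ := lintegral_map hm.lintegral_prod_right' hr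

lemma wellFormed_run (ω : Coins n) (t : ℕ) (i : Fin n) : WellFormed ((run κ A ω t).2 i) := by
  cases t with
  | zero => trivial
  | succ t => exact (slotAt κ A ω t).wellFormed_next i

/-! ### The expected makespan -/

open Classical in
/-- The drift of the potential in a single slot, scaled such that a live slot counts `1`. -/
lemma lintegral_potential_next_add_le {κ b : ℝ} (hκ : 0 < κ) (hb : 1 ≤ b) (hκb : 8 ≤ κ * b)
    {σ : Config n} (a : Action n) (hw : ∀ i, WellFormed (σ i)) :
    ∫⁻ u, ENNReal.ofReal (4 * potential b (playSlot κ σ a u).next) ∂slotMeasure n +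
        (if ∃ i, (arrive σ a i).Live then 1 else 0) ≤
      ENNReal.ofReal (4 * potential b σ) +
        68 * (if (∃ i, (arrive σ a i).Live) ∧ (a.jamData = true ∨ a.jamControl = true)
          then 1 else 0) := by
  by_cases hlive : ∃ i, (arrive σ a i).Live
  · have h1 := integral_potential_next_le_sub (a := a) hκ hb hκb hw hlive
    have hnn : ∀ u, 0 ≤ 4 * potential b (playSlot κ σ a u).next := fun u => by
      linarith [potential_nonneg b (playSlot κ σ a u).next]
    rw [← ofReal_integral_eq_lintegral_ofReal
      (integrable_comp_playSlot κ σ a fun x => 4 * potential b x.next)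
      (Filter.Eventually.of_forall hnn), integral_const_mul, if_pos hlive]
    have hI : 0 ≤ ∫ u, potential b (playSlot κ σ a u).next ∂slotMeasure n :=
      integral_nonneg fun u => potential_nonneg _ _
    have h2 : (68 * (if (∃ i, (arrive σ a i).Live) ∧ (a.jamData = true ∨ a.jamControl = true)
        then 1 else 0) : ℝ≥0∞) =
        ENNReal.ofReal (68 * ind (a.jamData = true ∨ a.jamControl = true)) := by
      by_cases hd : a.jamData = true ∨ a.jamControl = true
      · rw [if_pos ⟨hlive, hd⟩, ind_true hd]; simp
      · rw [if_neg fun h => hd h.2, ind_false hd]; simp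
    rw [h2, ← ENNReal.ofReal_one, ← ENNReal.ofReal_add (by positivity) (by norm_num),
      ← ENNReal.ofReal_add (mul_nonneg (by norm_num) (potential_nonneg _ _))
        (mul_nonneg (by norm_num) (ind_nonneg _))]
    exact ENNReal.ofReal_le_ofReal (by linarith)
  · simp only [next_eq_of_not_live hlive, potential_arrive, hlive]
    simp

open Classical in
lemma lintegral_potential_run_succ_add_le {κ b : ℝ} (hκ : 0 < κ) (hb : 1 ≤ b) (hκb : 8 ≤ κ * b)
    (A : Adversary n) (t : ℕ) :
    ∫⁻ ω, ENNReal.ofReal (4 * potential b (run κ A ω (t + 1)).2) ∂coinMeasure n +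
        ∫⁻ ω, (if (slotAt κ A ω t).IsLive then 1 else 0) ∂coinMeasure n ≤
      ∫⁻ ω, ENNReal.ofReal (4 * potential b (run κ A ω t).2) ∂coinMeasure n +
        68 * ∫⁻ ω, (if (slotAt κ A ω t).IsLive ∧ (slotAt κ A ω t).IsDisrupted then 1 else 0)
          ∂coinMeasure n := by
  have h1 := lintegral_slotAt κ A (fun x => ENNReal.ofReal (4 * potential b x.next)) t
  have hm1 := measurable_comp_slotAt κ A (fun x => if x.IsLive then (1 : ℝ≥0∞) else 0) t
  have hm2 := measurable_comp_slotAt κ A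
    (fun x => if x.IsLive ∧ x.IsDisrupted then (1 : ℝ≥0∞) else 0) t
  simp only [run_succ]
  rw [h1, ← lintegral_const_mul _ hm2, ← lintegral_add_right _ hm1,
    ← lintegral_add_right _ (hm2.const_mul _)]
  refine lintegral_mono fun ω => ?_
  convert lintegral_potential_next_add_le hκ hb hκb
    (A (run κ A ω t).1 (run κ A ω t).2) (wellFormed_run κ A ω t) <;> rfl

open Classical in
lemma sum_lintegral_live_add_le {κ b : ℝ} (hκ : 0 < κ) (hb : 1 ≤ b) (hκb : 8 ≤ κ * b)
    (A : Adversary n) (N : ℕ) :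
    ∑ t ∈ Finset.range N, ∫⁻ ω, (if (slotAt κ A ω t).IsLive then 1 else 0) ∂coinMeasure n +
        ∫⁻ ω, ENNReal.ofReal (4 * potential b (run κ A ω N).2) ∂coinMeasure n ≤
      ENNReal.ofReal (4 * potential b (fun _ : Fin n => .notArrived)) +
        68 * ∑ t ∈ Finset.range N, ∫⁻ ω, (if (slotAt κ A ω t).IsLive ∧
          (slotAt κ A ω t).IsDisrupted then 1 else 0) ∂coinMeasure n := by
  induction N with
  | zero => simp [run]
  | succ N ih =>
    rw [Finset.sum_range_succ, Finset.sum_range_succ, mul_add, add_assoc,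
      add_comm (∫⁻ ω, (if (slotAt κ A ω N).IsLive then 1 else 0) ∂coinMeasure n)]
    refine (add_le_add_right (lintegral_potential_run_succ_add_le hκ hb hκb A N) _).trans ?_
    rw [← add_assoc, ← add_assoc]
    exact add_le_add_left ih _

lemma potential_notArrived {b : ℝ} (hb : 1 ≤ b) :
    potential b (fun _ : Fin n => .notArrived) = 147456 * Real.exp b * n := by
  have h1 : maxDebt (fun _ : Fin n => PacketState.notArrived) = 0 := by simp [maxDebt, debt]
  have h2 : relaxTime b (fun _ : Fin n => PacketState.notArrived) = 0 :=
    relaxTime_eq_zero (by simp [contention, contribution]; linarith)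
  rw [potential, h1, h2]
  simp [credit]
  ring

lemma lintegral_makespan_le {κ b : ℝ} (hκ : 0 < κ) (hb : 1 ≤ b) (hκb : 8 ≤ κ * b)
    (A : Adversary n) :
    ∫⁻ ω, makespan κ A ω ∂coinMeasure n ≤
      ENNReal.ofReal (589824 * Real.exp b * n) +
        68 * ∫⁻ ω, disruptedSlots κ A ω ∂coinMeasure n := by
  classical
  unfold makespan disruptedSlots
  rw [lintegral_tsum fun t => (measurable_comp_slotAt κ A
      (fun x => if x.IsLive then (1 : ℝ≥0∞) else 0) t).aemeasurable,
    lintegral_tsum fun t => (measurable_comp_slotAt κ A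
      (fun x => if x.IsLive ∧ x.IsDisrupted then (1 : ℝ≥0∞) else 0) t).aemeasurable]
  refine ENNReal.tsum_le_of_sum_range_le fun N => ?_
  refine (le_add_right le_rfl).trans ((sum_lintegral_live_add_le hκ hb hκb A N).trans ?_)
  refine add_le_add (le_of_eq ?_) (mul_le_mul_right (ENNReal.sum_le_tsum _) _)
  rw [potential_notArrived hb]
  ring_nf

/-! ### The throughput -/

lemma Slot.succeedsFor_of_next_eq_finished (x : Slot n) {i : Fin n} (h : x.next i = .finished)
    (hc : x.config i ≠ .finished) : x.SucceedsFor i := by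
  cases h1 : x.config i with
  | notArrived => rw [x.next_notArrived i h1] at h; cases h
  | finished => exact absurd h1 hc
  | inactive => rcases x.next_inactive i h1 with ⟨-, h2⟩ | ⟨-, h2⟩ <;> rw [h2] at h <;> cases h
  | active s e =>
    rcases x.next_active i h1 with ⟨h2, -⟩ | ⟨-, -, ⟨-, h2⟩ | ⟨-, h2⟩⟩ | ⟨-, -, ⟨-, h2⟩ | ⟨-, h2⟩⟩
    · exact h2
    all_goals rw [h2] at h; cases h

lemma Slot.next_ne_notArrived (x : Slot n) {i : Fin n} (hc : x.config i ≠ .notArrived) :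
    x.next i ≠ .notArrived := by
  cases h1 : x.config i with
  | notArrived => exact absurd h1 hc
  | finished => rw [x.next_finished i h1]; simp
  | inactive => rcases x.next_inactive i h1 with ⟨-, h2⟩ | ⟨-, h2⟩ <;> rw [h2] <;> simp
  | active s e =>
    rcases x.next_active i h1 with ⟨-, h2⟩ | ⟨-, -, ⟨-, h2⟩ | ⟨-, h2⟩⟩ | ⟨-, -, ⟨-, h2⟩ | ⟨-, h2⟩⟩ <;>
      rw [h2] <;> simp

variable {κ A}

lemma exists_succeedsFor {ω : Coins n} (hinj : InjectsAll κ A ω) (hT : makespan κ A ω ≠ ∞)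
    (i : Fin n) : ∃ t, (slotAt κ A ω t).SucceedsFor i := by
  classical
  by_contra! hno
  have hstart : ∀ t, (run κ A ω t).2 i ≠ .finished ∧
      (slotAt κ A ω t).config i ≠ .finished := by
    have hcfg : ∀ t, (run κ A ω t).2 i ≠ .finished →
        (slotAt κ A ω t).config i ≠ .finished := fun t h => by
      change arrive (run κ A ω t).2 _ i ≠ _
      unfold arrive
      split_ifs <;> simp [h]
    intro t
    induction t with
    | zero => exact ⟨by simp [run], hcfg 0 (by simp [run])⟩
    | succ t ih =>
      have : (run κ A ω (t + 1)).2 i ≠ .finished := fun h =>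
        hno t ((slotAt κ A ω t).succeedsFor_of_next_eq_finished h ih.2)
      exact ⟨this, hcfg _ this⟩
  obtain ⟨t₀, ht₀⟩ := hinj i
  have harrived : ∀ t, t₀ ≤ t → (slotAt κ A ω t).config i ≠ .notArrived := by
    intro t ht
    induction t, ht using Nat.le_induction with
    | base => exact ht₀
    | succ t _ ih =>
      have h1 : (run κ A ω (t + 1)).2 i ≠ .notArrived := (slotAt κ A ω t).next_ne_notArrived ih
      change arrive (run κ A ω (t + 1)).2 _ i ≠ _
      unfold arrive
      split_ifs <;> simp [h1]
  have hlive : ∀ t, t₀ ≤ t → (slotAt κ A ω t).IsLive := fun t ht => ⟨i, by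
    have h1 := harrived t ht
    have h2 := (hstart t).2
    cases h : (slotAt κ A ω t).config i with
    | notArrived => exact h1 h
    | finished => exact h2 h
    | _ => trivial⟩
  have h0 := ENNReal.tendsto_atTop_zero_of_tsum_ne_top hT
  obtain ⟨t, ht, ht'⟩ := ((h0.eventually (gt_mem_nhds one_pos)).and
    (Filter.eventually_ge_atTop t₀)).exists
  rw [if_pos (hlive t ht')] at ht
  exact lt_irrefl _ ht

lemma le_successfulSlots {ω : Coins n} (hinj : InjectsAll κ A ω) (hT : makespan κ A ω ≠ ∞) :
    (n : ℝ≥0∞) ≤ successfulSlots κ A ω := by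
  classical
  choose t ht using exists_succeedsFor hinj hT
  have hti : Function.Injective t := fun i j hij => by
    have h1 := (ht i).2
    rw [hij, (ht j).2] at h1
    exact (Finset.singleton_injective h1).symm
  refine le_trans (le_of_eq ?_) (ENNReal.sum_le_tsum (Finset.univ.map ⟨t, hti⟩))
  rw [Finset.sum_map]
  simp only [Function.Embedding.coeFn_mk]
  rw [Finset.sum_congr rfl fun i _ => if_pos ⟨i, ht i⟩]
  simp

variable (κ A) in
lemma measurable_makespan : Measurable fun ω => makespan κ A ω := by
  classical
  exact Measurable.tsum fun t =>
    measurable_comp_slotAt κ A (fun x => if x.IsLive then (1 : ℝ≥0∞) else 0) t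

variable (κ A) in
lemma measurable_throughput : Measurable fun ω => throughput κ A ω := by
  classical
  exact (Measurable.tsum fun t => measurable_comp_slotAt κ A
    (fun x => if x.IsSuccessful then (1 : ℝ≥0∞) else 0) t).div (measurable_makespan κ A)

/-- If the expected makespan is at most `C n`, then with probability at least `1 / 2` the makespan
is below `2 C n`, and the throughput is at least `1 / (2 C)`. -/
lemma le_lintegral_throughput (hn : 1 ≤ n) {C : ℝ≥0} (hC : 0 < C)
    (hinj : ∀ᵐ ω ∂coinMeasure n, InjectsAll κ A ω)
    (hT : ∫⁻ ω, makespan κ A ω ∂coinMeasure n ≤ C * n) :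
    (((4 * C)⁻¹ : ℝ≥0) : ℝ≥0∞) ≤ ∫⁻ ω, throughput κ A ω ∂coinMeasure n := by
  have hC0 : (C : ℝ≥0∞) ≠ 0 := by exact_mod_cast hC.ne'
  have hn0 : (n : ℝ≥0∞) ≠ 0 := by exact_mod_cast (by omega : n ≠ 0)
  have hCn0 : (C * n : ℝ≥0∞) ≠ 0 := mul_ne_zero hC0 hn0
  have hCn : (C * n : ℝ≥0∞) ≠ ∞ := ENNReal.mul_ne_top ENNReal.coe_ne_top (ENNReal.natCast_ne_top n)
  have hlarge : coinMeasure n {ω | 2 * (C * n : ℝ≥0∞) ≤ makespan κ A ω} ≤ 2⁻¹ := by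
    refine (meas_ge_le_lintegral_div (measurable_makespan κ A).aemeasurable
      (mul_ne_zero two_ne_zero hCn0) (ENNReal.mul_ne_top ENNReal.ofNat_ne_top hCn)).trans ?_
    refine (ENNReal.div_le_div_right hT _).trans (le_of_eq ?_)
    rw [ENNReal.div_eq_inv_mul, ENNReal.mul_inv (Or.inl two_ne_zero) (Or.inl ENNReal.ofNat_ne_top),
      mul_assoc, ENNReal.inv_mul_cancel hCn0 hCn, mul_one]
  have hsmall : 2⁻¹ ≤ coinMeasure n {ω | 2 * (C * n : ℝ≥0∞) ≤ makespan κ A ω}ᶜ := by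
    rw [prob_compl_eq_one_sub (measurableSet_le measurable_const (measurable_makespan κ A)),
      ← ENNReal.one_sub_inv_two]
    exact tsub_le_tsub_left hlarge _
  have hthr : coinMeasure n {ω | 2 * (C * n : ℝ≥0∞) ≤ makespan κ A ω}ᶜ ≤
      coinMeasure n {ω | (2 * C : ℝ≥0∞)⁻¹ ≤ throughput κ A ω} := by
    refine measure_mono_ae ?_
    filter_upwards [hinj] with ω hω hsm
    have hlt : makespan κ A ω < 2 * (C * n : ℝ≥0∞) := not_le.1 hsm
    have hsucc := le_successfulSlots hω hlt.ne_top
    change _ ≤ successfulSlots κ A ω / makespan κ A ω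
    refine le_trans ?_ (ENNReal.div_le_div_right hsucc _)
    rw [ENNReal.le_div_iff_mul_le (Or.inr hn0) (Or.inr (ENNReal.natCast_ne_top n))]
    refine (mul_le_mul_right hlt.le _).trans (le_of_eq ?_)
    rw [← mul_assoc 2, ← mul_assoc, ENNReal.inv_mul_cancel (mul_ne_zero two_ne_zero hC0)
      (ENNReal.mul_ne_top ENNReal.ofNat_ne_top ENNReal.coe_ne_top), one_mul]
  refine le_trans ?_ (mul_meas_ge_le_lintegral (measurable_throughput κ A) (2 * C : ℝ≥0∞)⁻¹)
  refine le_trans (le_of_eq ?_) (mul_le_mul_right (hsmall.trans hthr) _)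
  rw [ENNReal.coe_inv (by positivity), ← ENNReal.mul_inv (Or.inr ENNReal.ofNat_ne_top)
    (Or.inr two_ne_zero)]
  congr 1
  push_cast
  ring

end ReBackoff

end

theorem mainTheorem2 (κ : ℝ) (hκ : 0 < κ) :
    ∃ c : ℝ, 0 < c ∧ ∃ lam C : ℝ≥0, 0 < lam ∧
      ∀ n : ℕ, 1 ≤ n → ∀ A : ReBackoff.Adversary n,
        (∀ᵐ ω ∂(ReBackoff.coinMeasure n), ReBackoff.InjectsAll κ A ω) →
        (∀ᵐ ω ∂(ReBackoff.coinMeasure n),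
          ReBackoff.disruptedSlots κ A ω ≤ ENNReal.ofReal (c * (n : ℝ))) →
        (lam : ℝ≥0∞) ≤ ∫⁻ ω, ReBackoff.throughput κ A ω ∂(ReBackoff.coinMeasure n) ∧
        ∫⁻ ω, ReBackoff.makespan κ A ω ∂(ReBackoff.coinMeasure n) ≤ (C : ℝ≥0∞) * (n : ℝ≥0∞) := by
  set b : ℝ := max 1 (8 / κ) with hbdef
  have hb : 1 ≤ b := le_max_left _ _
  have hκb : 8 ≤ κ * b := by
    have h := mul_le_mul_of_nonneg_left (le_max_right 1 (8 / κ)) hκ.le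
    rwa [mul_div_cancel₀ _ hκ.ne'] at h
  set C : ℝ≥0 := (589824 * Real.exp b + 68).toNNReal with hCdef
  have hC : 0 < C := Real.toNNReal_pos.2 (by positivity)
  -- The potential method tolerates any linear number of disrupted slots; `c = 1` will do.
  refine ⟨1, one_pos, (4 * C)⁻¹, C, by positivity, fun n hn A hinj hD => ?_⟩
  have hT : ∫⁻ ω, ReBackoff.makespan κ A ω ∂(ReBackoff.coinMeasure n) ≤
      (C : ℝ≥0∞) * (n : ℝ≥0∞) := by
    refine (ReBackoff.lintegral_makespan_le hκ hb hκb A).trans ?_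
    have hD' : ∫⁻ ω, ReBackoff.disruptedSlots κ A ω ∂(ReBackoff.coinMeasure n) ≤ n := by
      refine (lintegral_mono_ae hD).trans (le_of_eq ?_)
      simp
    refine (add_le_add_right (mul_le_mul_right hD' 68) _).trans (le_of_eq ?_)
    rw [ENNReal.ofReal_mul (by positivity), ENNReal.ofReal_natCast, ← add_mul,
      show (C : ℝ≥0∞) = ENNReal.ofReal (589824 * Real.exp b + 68) from rfl,
      ENNReal.ofReal_add (by positivity) (by norm_num)]
    simp
  exact ⟨ReBackoff.le_lintegral_throughput hn hC hinj hT, hT⟩
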